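/- For $n\ge 1$ let $\mathcal{L}_n$ be the free Lie algebra over $\mathbb{Z}$ on $x_1,\dots,x_n$. Write $[y_1,\dots,y_k]=[[\cdots[y_1,y_2],\dots],y_k]$ for left-normed commutators, and for $C\in\mathcal{L}_n$ let $x_i^*\otimes C$ be the derivation of $\mathcal{L}_n$ that sends $x_i$ to $C$ and $x_m$ to $0$ for $m\ne i$. For $k\ge 1$ let $\mathfrak{p}_n(k)$ be the $\mathbb{Z}$-module generated by the derivations $x_i^*\otimes[x_{j_1},\dots,x_{j_k},x_i]$, $1\le i,j_1,\dots,j_k\le n$, and let $$\mathfrak{b}_n(k)=\Big\{\sum_{i=1}^n x_i^*\otimes C_i\in\mathfrak{p}_n(k)\ \Big|\ \sum_{i=1}^n C_i=0\Big\}.$$ The sum $\mathfrak{b}_n=\bigoplus_{k\ge1}\mathfrak{b}_n(k)$ is a graded Lie subalgebra of the Lie algebra of derivations of $\mathcal{L}_n$ (the special derivation Lie algebra). Put $\mathfrak{b}_n^{\mathbb{Q}}=\mathfrak{b}_n\otimes_{\mathbb{Z}}\mathbb{Q}$ and $\mathfrak{b}_n^{\mathbb{Q}}(k)=\mathfrak{b}_n(k)\otimes_{\mathbb{Z}}\mathbb{Q}$.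 Let $H_1(\mathfrak{b}_n,\mathbb{Z})=\mathfrak{b}_n/[\mathfrak{b}_n,\mathfrak{b}_n]$ and $H_1(\mathfrak{b}_n,\mathbb{Q})=\mathfrak{b}_n^{\mathbb{Q}}/[\mathfrak{b}_n^{\mathbb{Q}},\mathfrak{b}_n^{\mathbb{Q}}]$, with degree $k$ parts $H_1(\mathfrak{b}_n,\mathbb{Z})_k$ and $H_1(\mathfrak{b}_n,\mathbb{Q})_k$. For submodules $U,V$ of a Lie algebra, $[U,V]$ denotes the submodule generated by all $[u,v]$ with $u\in U$, $v\in V$. **Proposition.** For every $n\ge 4$, $$\mathfrak{b}_n^{\mathbb{Q}}(4)=[\mathfrak{b}_n^{\mathbb{Q}}(3),\mathfrak{b}_n^{\mathbb{Q}}(1)],\qquad\text{and hence}\qquad H_1(\mathfrak{b}_n,\mathbb{Q})_4=0.$$ Moreover $$\mathfrak{b}_3(4)=[\mathfrak{b}_3(3),\mathfrak{b}_3(1)],\qquad\text{and hence}\qquad H_1(\mathfrak{b}_3,\mathbb{Z})_4=0.$$ -/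

import Mathlib

noncomputable section

namespace SpecialDer

open scoped TensorProduct

/-! ### Derivations of a free Lie algebra with prescribed values on the generators -/

section Tangent

variable (L : Type*) [LieRing L]

/-- The Lie algebra `L ⊕ ε L` with `ε ^ 2 = 0`; an auxiliary object, used only to extend a map on
generators to a derivation. -/
@[ext] structure Tangent where
  /-- the component in `L` -/
  base : L
  /-- the component in `ε L` -/
  vec : L

variable {L}

/-- As a set, `L ⊕ ε L` is the product `L × L`. -/
def Tangent.toProd : Tangent L ≃ L × L where
  toFun a := (a.base, a.vec)
  invFun a := ⟨a.1, a.2⟩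
  left_inv _ := rfl
  right_inv _ := rfl

instance : AddCommGroup (Tangent L) := Tangent.toProd.addCommGroup

instance {R : Type*} [CommRing R] [LieAlgebra R L] : Module R (Tangent L) := Tangent.toProd.module R

instance : Bracket (Tangent L) (Tangent L) where
  bracket a b := ⟨⁅a.base, b.base⁆, ⁅a.base, b.vec⁆ + ⁅a.vec, b.base⁆⟩

theorem Tangent.zero_eq : (0 : Tangent L) = ⟨0, 0⟩ := rfl

theorem Tangent.add_eq (a b : Tangent L) : a + b = ⟨a.base + b.base, a.vec + b.vec⟩ := rfl

theorem Tangent.smul_eq {R : Type*} [CommRing R] [LieAlgebra R L] (t : R) (a : Tangent L) :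
    t • a = ⟨t • a.base, t • a.vec⟩ := rfl

theorem Tangent.lie_eq (a b : Tangent L) :
    ⁅a, b⁆ = ⟨⁅a.base, b.base⁆, ⁅a.base, b.vec⁆ + ⁅a.vec, b.base⁆⟩ := rfl

instance : LieRing (Tangent L) where
  add_lie a b c := by
    simp only [Tangent.add_eq, Tangent.lie_eq, add_lie, Tangent.mk.injEq, true_and]
    abel
  lie_add a b c := by
    simp only [Tangent.add_eq, Tangent.lie_eq, lie_add, Tangent.mk.injEq, true_and]
    abel
  lie_self a := by
    simp only [Tangent.zero_eq, Tangent.lie_eq, lie_self, Tangent.mk.injEq, true_and]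
    rw [← lie_skew, neg_add_cancel]
  leibniz_lie a b c := by
    simp only [Tangent.add_eq, Tangent.lie_eq, lie_add, add_lie, Tangent.mk.injEq]
    refine ⟨leibniz_lie _ _ _, ?_⟩
    rw [leibniz_lie a.base b.base c.vec, leibniz_lie a.base b.vec c.base,
      leibniz_lie a.vec b.base c.base]
    abel

instance {R : Type*} [CommRing R] [LieAlgebra R L] : LieAlgebra R (Tangent L) where
  lie_smul t a b := by
    simp only [Tangent.smul_eq, Tangent.lie_eq, lie_smul, smul_add]

end Tangent

variable (R : Type*) [CommRing R] (n : ℕ)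

/-- The free Lie algebra `𝓛_n` over `R` on the generators `x_0, …, x_{n-1}`. -/
abbrev Free : Type _ := FreeLieAlgebra R (Fin n)

variable {n}

/-- The generator `x_i`. -/
abbrev x (i : Fin n) : Free R n := FreeLieAlgebra.of R i

/-- The Lie homomorphism `𝓛_n → 𝓛_n ⊕ ε 𝓛_n` with `x_i ↦ x_i + ε C_i`. -/
def tangentLift (C : Fin n → Free R n) : Free R n →ₗ⁅R⁆ Tangent (Free R n) :=
  FreeLieAlgebra.lift R fun i => ⟨x R i, C i⟩

theorem tangentLift_base (C : Fin n → Free R n) (a : Free R n) :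
    (tangentLift R C a).base = a := by
  let π : Tangent (Free R n) →ₗ⁅R⁆ Free R n :=
    { toFun := Tangent.base
      map_add' := fun _ _ => rfl
      map_smul' := fun _ _ => rfl
      map_lie' := rfl }
  have h : π.comp (tangentLift R C) = LieHom.id := by
    apply FreeLieAlgebra.hom_ext
    intro i
    change (tangentLift R C (x R i)).base = x R i
    simp [tangentLift]
  exact LieHom.congr_fun h a

/-- The derivation of `𝓛_n` with `x_i ↦ C_i` for every `i`, that is, `∑ i, x_i^* ⊗ C_i`. -/
def ofValues (C : Fin n → Free R n) : LieDerivation R (Free R n) (Free R n) where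
  toFun a := (tangentLift R C a).vec
  map_add' a b := by rw [map_add]; rfl
  map_smul' t a := by rw [map_smul]; rfl
  leibniz' a b := by
    change (tangentLift R C ⁅a, b⁆).vec =
      ⁅a, (tangentLift R C b).vec⁆ - ⁅b, (tangentLift R C a).vec⁆
    rw [LieHom.map_lie, Tangent.lie_eq, tangentLift_base, tangentLift_base,
      ← lie_skew b, sub_neg_eq_add]

theorem ofValues_x (C : Fin n → Free R n) (i : Fin n) : ofValues R C (x R i) = C i := by
  change (tangentLift R C (x R i)).vec = C i
  simp [tangentLift]

/-- The derivation `x_i^* ⊗ C`: it sends `x_i` to `C` and every other generator to `0`. -/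
def dualTensor (i : Fin n) (C : Free R n) : LieDerivation R (Free R n) (Free R n) :=
  ofValues R (Pi.single i C)

/-- The left-normed commutator `[x_{j_1}, x_{j_2}, …, x_{j_k}] = [[…[x_{j_1}, x_{j_2}], …], x_{j_k}]`
of the word `j_1, …, j_k` (and `0` for the empty word). -/
def leftNormed : List (Fin n) → Free R n
  | [] => 0
  | j :: w => w.foldl (fun c m => ⁅c, x R m⁆) (x R j)

variable (n)

/-! ### Tangential and special derivations -/

/-- `𝔭_n(k)`, for `k ≥ 1`: the module of derivations of `𝓛_n` generated by
`x_i^* ⊗ [x_{j_1}, …, x_{j_k}, x_i]` for all `i, j_1, …, j_k`. -/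
def tangential (k : ℕ) : Submodule R (LieDerivation R (Free R n) (Free R n)) :=
  Submodule.span R
    {D | ∃ (i : Fin n) (w : List (Fin n)), w.length = k ∧
      D = dualTensor R i (leftNormed R (w ++ [i]))}

/-- `𝔟_n(k)`, for `k ≥ 1`: the elements `∑ i, x_i^* ⊗ C_i` of `𝔭_n(k)` with `∑ i, C_i = 0`. -/
def special (k : ℕ) : Submodule R (LieDerivation R (Free R n) (Free R n)) where
  carrier := {D | D ∈ tangential R n k ∧ ∑ i, D (x R i) = 0}
  add_mem' := by
    rintro D E ⟨hD, hD'⟩ ⟨hE, hE'⟩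
    refine ⟨add_mem hD hE, ?_⟩
    simp only [LieDerivation.add_apply, Finset.sum_add_distrib, hD', hE', add_zero]
  zero_mem' := ⟨zero_mem _, by simp⟩
  smul_mem' := by
    rintro t D ⟨hD, hD'⟩
    refine ⟨Submodule.smul_mem _ t hD, ?_⟩
    simp only [LieDerivation.smul_apply, ← Finset.smul_sum, hD', smul_zero]

/-! ### The special derivations form a Lie algebra -/

/-- The degree `k` part of `𝓛_n`, generated by the left-normed commutators of weight `k`. -/
def freePart (k : ℕ) : Submodule R (Free R n) :=
  Submodule.span R {c | ∃ w : List (Fin n), w.length = k ∧ c = leftNormed R w}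

variable {n}

theorem leftNormed_append {w : List (Fin n)} (hw : w ≠ []) (i : Fin n) :
    leftNormed R (w ++ [i]) = ⁅leftNormed R w, x R i⁆ := by
  cases w with
  | nil => exact absurd rfl hw
  | cons j w => simp [leftNormed, List.foldl_append]

theorem derivation_ext {D E : LieDerivation R (Free R n) (Free R n)}
    (h : ∀ i, D (x R i) = E (x R i)) : D = E := by
  suffices key : ∀ F : LieDerivation R (Free R n) (Free R n), (∀ i, F (x R i) = 0) → F = 0 by
    exact sub_eq_zero.mp (key (D - E) fun i => by rw [LieDerivation.sub_apply, h i, sub_self])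
  intro F hF
  let φ : Free R n →ₗ⁅R⁆ Tangent (Free R n) :=
    { toFun := fun a => ⟨a, F a⟩
      map_add' := fun a b => by rw [map_add]; rfl
      map_smul' := fun t a => by rw [map_smul]; rfl
      map_lie' := fun {a b} => by
        rw [Tangent.lie_eq, LieDerivation.apply_lie_eq_add] }
  let ψ : Free R n →ₗ⁅R⁆ Tangent (Free R n) :=
    { toFun := fun a => ⟨a, 0⟩
      map_add' := fun a b => by simp [Tangent.add_eq]
      map_smul' := fun t a => by simp [Tangent.smul_eq]
      map_lie' := fun {a b} => by simp [Tangent.lie_eq] }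
  have hφψ : φ = ψ := by
    apply FreeLieAlgebra.hom_ext
    intro i
    change (⟨x R i, F (x R i)⟩ : Tangent (Free R n)) = ⟨x R i, 0⟩
    rw [hF i]
  ext a
  exact congrArg Tangent.vec (LieHom.congr_fun hφψ a)

theorem lie_x_mem {k : ℕ} {c : Free R n} (hc : c ∈ freePart R n (k + 1)) (i : Fin n) :
    ⁅c, x R i⁆ ∈ freePart R n (k + 2) := by
  refine Submodule.span_induction
    (p := fun c _ => ⁅c, x R i⁆ ∈ freePart R n (k + 2)) ?_ ?_ ?_ ?_ hc
  · rintro _ ⟨w, hw, rfl⟩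
    have hne : w ≠ [] := by rintro rfl; simp at hw
    rw [← leftNormed_append R hne]
    exact Submodule.subset_span ⟨_, by simp [hw], rfl⟩
  · simp
  · intro a b _ _ ha hb
    rw [add_lie]; exact add_mem ha hb
  · intro t a _ ha
    rw [smul_lie]; exact Submodule.smul_mem _ t ha

/-- To prove a linear property of the homogeneous elements, check the generators, and go from
`c` to `⁅c, x_i⁆`. -/
theorem freePart_induction {P : ℕ → Submodule R (Free R n)}
    (h1 : ∀ i, x R i ∈ P 0)
    (h2 : ∀ l, ∀ d ∈ freePart R n (l + 1), d ∈ P l → ∀ i, ⁅d, x R i⁆ ∈ P (l + 1)) (l : ℕ) :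
    freePart R n (l + 1) ≤ P l := by
  have key : ∀ (l : ℕ) (w : List (Fin n)), w.length = l + 1 → leftNormed R w ∈ P l := by
    intro l
    induction l with
    | zero =>
      intro w hw
      obtain ⟨i, rfl⟩ := List.length_eq_one_iff.mp hw
      exact h1 i
    | succ l ih =>
      intro w hw
      obtain ⟨w', i, rfl⟩ : ∃ w' i, w = w' ++ [i] := by
        rcases List.eq_nil_or_concat w with rfl | ⟨w', i, h⟩
        · simp at hw
        · exact ⟨w', i, by simpa using h⟩
      have hw' : w'.length = l + 1 := by simpa using hw
      have hne : w' ≠ [] := by rintro rfl; simp at hw'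
      rw [leftNormed_append R hne]
      exact h2 l _ (Submodule.subset_span ⟨w', hw', rfl⟩) (ih w' hw') i
  refine Submodule.span_le.mpr ?_
  rintro _ ⟨w, hw, rfl⟩
  exact key l w hw

theorem lie_mem_freePart {l : ℕ} {d : Free R n} (hd : d ∈ freePart R n (l + 1)) :
    ∀ {k : ℕ} {c : Free R n}, c ∈ freePart R n (k + 1) → ⁅c, d⁆ ∈ freePart R n (k + l + 2) := by
  let P : ℕ → Submodule R (Free R n) := fun l =>
    { carrier := {d | ∀ k, ∀ c ∈ freePart R n (k + 1), ⁅c, d⁆ ∈ freePart R n (k + l + 2)}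
      add_mem' := fun {a b} ha hb k c hc => by
        rw [lie_add]; exact add_mem (ha k c hc) (hb k c hc)
      zero_mem' := fun k c _ => by rw [lie_zero]; exact zero_mem _
      smul_mem' := fun t a ha k c hc => by
        rw [lie_smul]; exact Submodule.smul_mem _ t (ha k c hc) }
  have h := freePart_induction R (P := P) (fun i k c hc => lie_x_mem R hc i) (by
    intro l d _ hdP i k c hc
    have e : ⁅c, ⁅d, x R i⁆⁆ = ⁅⁅c, d⁆, x R i⁆ - ⁅⁅c, x R i⁆, d⁆ := by
      rw [leibniz_lie c d, ← lie_skew d ⁅c, x R i⁆]; abel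
    rw [e]
    refine sub_mem (lie_x_mem R (hdP k c hc) i) ?_
    have := hdP (k + 1) _ (lie_x_mem R hc i)
    rwa [show k + 1 + l + 2 = k + (l + 1) + 2 by ring] at this) l hd
  intro k c hc
  exact h k c hc

theorem apply_mem_freePart {k : ℕ} {D : LieDerivation R (Free R n) (Free R n)}
    (hD : ∀ i, D (x R i) ∈ freePart R n (k + 1)) {l : ℕ} {d : Free R n}
    (hd : d ∈ freePart R n (l + 1)) : D d ∈ freePart R n (k + l + 1) := by
  have h := freePart_induction R
    (P := fun l => (freePart R n (k + l + 1)).comap (D : Free R n →ₗ[R] Free R n)) hD (by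
      intro l d hd hdP i
      change D ⁅d, x R i⁆ ∈ freePart R n (k + (l + 1) + 1)
      rw [LieDerivation.apply_lie_eq_add]
      refine add_mem ?_ (lie_x_mem R hdP i)
      have hx := lie_mem_freePart R (hD i) hd
      rwa [show l + k + 2 = k + (l + 1) + 1 by ring] at hx) l hd
  exact h

theorem mem_tangential_iff {k : ℕ} {D : LieDerivation R (Free R n) (Free R n)} :
    D ∈ tangential R n (k + 1) ↔ ∀ i, ∃ c ∈ freePart R n (k + 1), D (x R i) = ⁅c, x R i⁆ := by
  constructor
  · intro hD
    refine Submodule.span_induction (p := fun D _ =>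
      ∀ i, ∃ c ∈ freePart R n (k + 1), D (x R i) = ⁅c, x R i⁆) ?_ ?_ ?_ ?_ hD
    · rintro _ ⟨j, w, hw, rfl⟩ i
      have hne : w ≠ [] := by rintro rfl; simp at hw
      rw [dualTensor, ofValues_x, leftNormed_append R hne]
      rcases eq_or_ne i j with rfl | hij
      · exact ⟨_, Submodule.subset_span ⟨w, hw, rfl⟩, by simp⟩
      · exact ⟨0, zero_mem _, by simp [hij]⟩
    · intro i
      exact ⟨0, zero_mem _, by simp⟩
    · intro D E _ _ hD hE i
      obtain ⟨c, hc, hc'⟩ := hD i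
      obtain ⟨d, hd, hd'⟩ := hE i
      exact ⟨c + d, add_mem hc hd, by rw [LieDerivation.add_apply, hc', hd', add_lie]⟩
    · intro t D _ hD i
      obtain ⟨c, hc, hc'⟩ := hD i
      exact ⟨t • c, Submodule.smul_mem _ t hc, by rw [LieDerivation.smul_apply, hc', smul_lie]⟩
  · intro h
    choose c hc hc' using h
    have hsum : D = ∑ i, dualTensor R i ⁅c i, x R i⁆ := by
      apply derivation_ext
      intro m
      have e : (∑ i, dualTensor R i ⁅c i, x R i⁆) (x R m)
          = ∑ i, (dualTensor R i ⁅c i, x R i⁆) (x R m) :=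
        map_sum (AddMonoidHom.mk' (fun D : LieDerivation R (Free R n) (Free R n) => D (x R m))
          (fun _ _ => rfl)) _ _
      rw [e, hc' m]
      simp only [dualTensor, ofValues_x]
      rw [Finset.sum_pi_single]
      simp
    rw [hsum]
    refine sum_mem fun i _ => ?_
    refine Submodule.span_induction (p := fun c _ =>
      dualTensor R i ⁅c, x R i⁆ ∈ tangential R n (k + 1)) ?_ ?_ ?_ ?_ (hc i)
    · rintro _ ⟨w, hw, rfl⟩
      have hne : w ≠ [] := by rintro rfl; simp at hw
      rw [← leftNormed_append R hne]
      exact Submodule.subset_span ⟨i, w, hw, rfl⟩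
    · have : dualTensor R i ⁅(0 : Free R n), x R i⁆ = 0 :=
        derivation_ext R fun m => by simp [dualTensor, ofValues_x]
      rw [this]; exact zero_mem _
    · intro a b _ _ ha hb
      have : dualTensor R i ⁅a + b, x R i⁆
          = dualTensor R i ⁅a, x R i⁆ + dualTensor R i ⁅b, x R i⁆ :=
        derivation_ext R fun m => by
          simp [dualTensor, ofValues_x, add_lie, Pi.single_add]
      rw [this]; exact add_mem ha hb
    · intro t a _ ha
      have : dualTensor R i ⁅t • a, x R i⁆ = t • dualTensor R i ⁅a, x R i⁆ :=
        derivation_ext R fun m => by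
          simp [dualTensor, ofValues_x, smul_lie, Pi.single_smul]
      rw [this]; exact Submodule.smul_mem _ t ha

theorem lie_mem_special {k l : ℕ} {D E : LieDerivation R (Free R n) (Free R n)}
    (hD : D ∈ special R n (k + 1)) (hE : E ∈ special R n (l + 1)) :
    ⁅D, E⁆ ∈ special R n (k + l + 1 + 1) := by
  obtain ⟨hD, hD'⟩ := hD
  obtain ⟨hE, hE'⟩ := hE
  rw [mem_tangential_iff] at hD hE
  have hDx : ∀ i, D (x R i) ∈ freePart R n (k + 1 + 1) := fun i => by
    obtain ⟨c, hc, e⟩ := hD i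
    rw [e]; exact lie_x_mem R hc i
  have hEx : ∀ i, E (x R i) ∈ freePart R n (l + 1 + 1) := fun i => by
    obtain ⟨c, hc, e⟩ := hE i
    rw [e]; exact lie_x_mem R hc i
  refine ⟨(mem_tangential_iff R).mpr fun i => ?_, ?_⟩
  · obtain ⟨c, hc, ec⟩ := hD i
    obtain ⟨d, hd, ed⟩ := hE i
    refine ⟨D d - E c - ⁅c, d⁆, sub_mem (sub_mem ?_ ?_) (lie_mem_freePart R hd hc), ?_⟩
    · have := apply_mem_freePart R hDx hd
      rwa [show k + 1 + l + 1 = k + l + 1 + 1 by ring] at this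
    · have := apply_mem_freePart R hEx hc
      rwa [show l + 1 + k + 1 = k + l + 1 + 1 by ring] at this
    · rw [LieDerivation.commutator_apply, ed, ec, LieDerivation.apply_lie_eq_add,
        LieDerivation.apply_lie_eq_add, ec, ed, sub_lie, sub_lie, lie_lie]
      abel
  · have e : ∑ i, ⁅D, E⁆ (x R i) = D (∑ i, E (x R i)) - E (∑ i, D (x R i)) := by
      simp only [LieDerivation.commutator_apply, Finset.sum_sub_distrib, map_sum]
    change ∑ i, ⁅D, E⁆ (x R i) = 0
    rw [e, hD', hE', map_zero, map_zero, sub_zero]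

variable (n)

/-- The special derivation Lie algebra `𝔟_n = ⨁_{k ≥ 1} 𝔟_n(k)`, a Lie subalgebra of the Lie algebra
of derivations of `𝓛_n`. -/
def specialLie : LieSubalgebra R (LieDerivation R (Free R n) (Free R n)) where
  toSubmodule := ⨆ k : ℕ, special R n (k + 1)
  lie_mem' := by
    intro D E hD hE
    change D ∈ ⨆ k : ℕ, special R n (k + 1) at hD
    change E ∈ ⨆ k : ℕ, special R n (k + 1) at hE
    change ⁅D, E⁆ ∈ ⨆ k : ℕ, special R n (k + 1)
    induction hD using Submodule.iSup_induction' with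
    | zero => rw [zero_lie]; exact zero_mem _
    | add a b _ _ ha hb => rw [add_lie]; exact add_mem ha hb
    | mem k a ha =>
      induction hE using Submodule.iSup_induction' with
      | zero => rw [lie_zero]; exact zero_mem _
      | add c d _ _ hc hd => rw [lie_add]; exact add_mem hc hd
      | mem l c hc =>
        exact Submodule.mem_iSup_of_mem (k + l + 1) (lie_mem_special R ha hc)

/-- `𝔟_n(k)`, for `k ≥ 1`, as a submodule of `𝔟_n`. -/
def part (k : ℕ) : Submodule R (specialLie R n) :=
  (special R n k).comap (specialLie R n).toSubmodule.subtype

/-- `𝔟_n ⊗_R A`, a Lie algebra over the `R`-algebra `A`. -/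
abbrev specialLieExt (A : Type*) [CommRing A] [Algebra R A] : Type _ :=
  A ⊗[R] specialLie R n

/-- `𝔟_n(k) ⊗_R A`, for `k ≥ 1`, as a submodule of `𝔟_n ⊗_R A`. -/
def partExt (A : Type*) [CommRing A] [Algebra R A] (k : ℕ) :
    Submodule A (specialLieExt R n A) :=
  (part R n k).baseChange A

/-! ### Brackets of submodules and the first homology of a Lie algebra -/

variable {R} {𝔤 : Type*} [LieRing 𝔤] [LieAlgebra R 𝔤]

/-- For submodules `U` and `V` of a Lie algebra, the submodule `[U, V]` generated by all brackets
`[u, v]` with `u ∈ U` and `v ∈ V`. -/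
def bracketSpan (U V : Submodule R 𝔤) : Submodule R 𝔤 :=
  Submodule.span R {z | ∃ u ∈ U, ∃ v ∈ V, ⁅u, v⁆ = z}

/-- `H_1(𝔤, R) = 𝔤 / [𝔤, 𝔤]`, the abelianization of the Lie algebra `𝔤` over `R`. -/
abbrev H1 (R 𝔤 : Type*) [CommRing R] [LieRing 𝔤] [LieAlgebra R 𝔤] : Type _ :=
  𝔤 ⧸ (⁅(⊤ : LieIdeal R 𝔤), (⊤ : LieIdeal R 𝔤)⁆ : LieIdeal R 𝔤)

/-- The image of a submodule `U` of `𝔤` in `H_1(𝔤, R)`; for the degree `k` part `U` of a graded Lie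
algebra `𝔤` this is the degree `k` part `H_1(𝔤, R)_k`. -/
def H1Part (U : Submodule R 𝔤) : Submodule R (H1 R 𝔤) :=
  U.map (LieSubmodule.Quotient.mk'
    (⁅(⊤ : LieIdeal R 𝔤), (⊤ : LieIdeal R 𝔤)⁆ : LieIdeal R 𝔤) : 𝔤 →ₗ[R] H1 R 𝔤)

end SpecialDer

end

/-! Special derivations are described by trivalent trees with labelled leaves: the value at `x m` is
the sum, over leaves labelled `m`, of the bracket of `x m` with the tree read from that leaf as
root. A strut acts on trees by grafting a fork at a leaf carrying one of its two labels
(`lie_strut_tree₄`, `lie_strut_halfTree₄`). Two facts then suffice.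

First, over any commutative ring the five-leaf trees span a module containing everything special of
degree 4 (`special_four_le`). Expanding the relation `∑ ⁅c i, x i⁆ = 0` in associative words and
keeping only the words with a given last letter `b` writes (multiplicity of `b`) times each
multidegree component as a combination of trees (`count_smul_component`). The multiplicities add up
to 5. One strictly between 0 and 5 is prime to 5, which gives the component itself; a multiplicity
of 5 forces the component to vanish.

Second, modulo brackets of degrees 3 and 1 all five-leaf trees vanish, except those with the same
label in both forks and four distinct labels in all; for these only the double is shown to vanish
(`tree₅_two_nsmul_mem`). Inverting 2 settles the rational claim. With three generators the
exceptional trees do not occur, so the claim holds over ℤ. -/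

noncomputable section

namespace SpecialDer

open scoped TensorProduct

/-! ### The Jacobi identity at a fork. -/

section LieIdentities

variable {L : Type*} [LieRing L]

/-- The two leaves of a fork `a, b` attached to a subtree `u` contribute together one bracket across
the edge joining them; this makes the sums over all leaves cancel. -/
theorem lie_lie_add_lie_lie (u a b : L) : ⁅⁅b, u⁆, a⁆ + ⁅⁅u, a⁆, b⁆ = ⁅u, ⁅a, b⁆⁆ := by
  rw [leibniz_lie u a b, ← lie_skew b u, neg_lie, lie_skew, add_comm]

end LieIdentities

/-! ### Derivations attached to trees, and the action of struts. -/

section Trees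

variable (R : Type*) [CommRing R] {n : ℕ}

/-- The Kronecker symbol. -/
def kron (p m : Fin n) : R := if p = m then 1 else 0

/-- The tangential derivation `x_m ↦ ⁅c_m, x_m⁆`. -/
def tangentialOf : (Fin n → Free R n) →ₗ[R] LieDerivation R (Free R n) (Free R n) where
  toFun c := ofValues R fun m => ⁅c m, x R m⁆
  map_add' c d := derivation_ext R fun m => by simp [ofValues_x]
  map_smul' t c := derivation_ext R fun m => by simp [ofValues_x]

variable {R}

theorem kron_comm (p m : Fin n) : kron R p m = kron R m p := by
  simp [kron, eq_comm]

@[simp] theorem kron_self (p : Fin n) : kron R p p = 1 := by simp [kron]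

theorem kron_ne {p m : Fin n} (h : p ≠ m) : kron R p m = 0 := by simp [kron, h]

@[simp] theorem tangentialOf_x (c : Fin n → Free R n) (m : Fin n) :
    tangentialOf R c (x R m) = ⁅c m, x R m⁆ := ofValues_x R _ m

theorem lie_tangentialOf (c d : Fin n → Free R n) :
    ⁅tangentialOf R c, tangentialOf R d⁆ = tangentialOf R fun m =>
      tangentialOf R c (d m) - tangentialOf R d (c m) - ⁅c m, d m⁆ := by
  refine derivation_ext R fun m => ?_
  rw [LieDerivation.commutator_apply]
  simp only [tangentialOf_x, LieDerivation.apply_lie_eq_add, sub_lie, lie_lie]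
  abel

theorem sum_kron_lie (u : Free R n) (p : Fin n) :
    ∑ m, ⁅kron R p m • u, x R m⁆ = ⁅u, x R p⁆ := by
  rw [Finset.sum_eq_single p]
  · simp
  · intro m _ h
    simp [kron_ne h.symm]
  · simp

theorem tangentialOf_mem_special {k : ℕ} {c : Fin n → Free R n}
    (hc : ∀ m, c m ∈ freePart R n (k + 1)) (h : ∑ m, ⁅c m, x R m⁆ = 0) :
    tangentialOf R c ∈ special R n (k + 1) :=
  ⟨(mem_tangential_iff R).mpr fun m => ⟨c m, hc m, tangentialOf_x c m⟩, by simpa using h⟩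

variable (R)

/-- The degree one special derivation given by the tree with one edge and leaves `i, j`. -/
def strut (i j : Fin n) : LieDerivation R (Free R n) (Free R n) :=
  tangentialOf R fun m => kron R i m • x R j + kron R j m • x R i

/-- The degree three special derivation given by the tree with forks `a, b` and `c, d`. -/
def tree₄ (a b c d : Fin n) : LieDerivation R (Free R n) (Free R n) :=
  tangentialOf R fun m =>
    kron R a m • ⁅x R b, ⁅x R c, x R d⁆⁆ + kron R b m • ⁅⁅x R c, x R d⁆, x R a⁆ +
    kron R c m • ⁅x R d, ⁅x R a, x R b⁆⁆ + kron R d m • ⁅⁅x R a, x R b⁆, x R c⁆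

/-- One half of the tree with two equal forks `a, b`. -/
def halfTree₄ (a b : Fin n) : LieDerivation R (Free R n) (Free R n) :=
  tangentialOf R fun m =>
    kron R a m • ⁅x R b, ⁅x R a, x R b⁆⁆ + kron R b m • ⁅⁅x R a, x R b⁆, x R a⁆

/-- The degree four special derivation given by the tree with forks `p, q` and `s, e` and middle
leaf `r`. -/
def tree₅ (p q r s e : Fin n) : LieDerivation R (Free R n) (Free R n) :=
  tangentialOf R fun m =>
    kron R p m • ⁅x R q, ⁅x R r, ⁅x R s, x R e⁆⁆⁆ +
    kron R q m • ⁅⁅x R r, ⁅x R s, x R e⁆⁆, x R p⁆ +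
    kron R r m • ⁅⁅x R s, x R e⁆, ⁅x R p, x R q⁆⁆ +
    kron R s m • ⁅x R e, ⁅⁅x R p, x R q⁆, x R r⁆⁆ +
    kron R e m • ⁅⁅⁅x R p, x R q⁆, x R r⁆, x R s⁆

variable {R}

theorem x_mem_freePart (i : Fin n) : x R i ∈ freePart R n (0 + 1) :=
  Submodule.subset_span ⟨[i], rfl, rfl⟩

theorem lie_x_x_mem_freePart (i j : Fin n) : ⁅x R i, x R j⁆ ∈ freePart R n (1 + 1) :=
  lie_mem_freePart R (x_mem_freePart j) (x_mem_freePart i)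

theorem strut_mem_special (i j : Fin n) : strut R i j ∈ special R n 1 := by
  refine tangentialOf_mem_special (k := 0) (fun m => ?_) ?_
  · exact add_mem (Submodule.smul_mem _ _ (x_mem_freePart j))
      (Submodule.smul_mem _ _ (x_mem_freePart i))
  · simp only [add_lie, Finset.sum_add_distrib, sum_kron_lie]
    rw [← lie_skew, neg_add_cancel]

theorem lie_x_lie_mem_freePart (i j k : Fin n) :
    ⁅x R i, ⁅x R j, x R k⁆⁆ ∈ freePart R n (2 + 1) :=
  lie_mem_freePart R (lie_x_x_mem_freePart j k) (x_mem_freePart i)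

theorem lie_lie_x_mem_freePart (i j k : Fin n) :
    ⁅⁅x R i, x R j⁆, x R k⁆ ∈ freePart R n (2 + 1) :=
  lie_mem_freePart R (x_mem_freePart k) (lie_x_x_mem_freePart i j)

theorem tree₄_mem_special (a b c d : Fin n) : tree₄ R a b c d ∈ special R n 3 := by
  refine tangentialOf_mem_special (k := 2) (fun m => ?_) ?_
  · exact add_mem (add_mem (add_mem
      (Submodule.smul_mem _ _ (lie_x_lie_mem_freePart b c d))
      (Submodule.smul_mem _ _ (lie_lie_x_mem_freePart c d a)))
      (Submodule.smul_mem _ _ (lie_x_lie_mem_freePart d a b)))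
      (Submodule.smul_mem _ _ (lie_lie_x_mem_freePart a b c))
  · simp only [add_lie, Finset.sum_add_distrib, sum_kron_lie]
    rw [lie_lie_add_lie_lie, add_assoc, lie_lie_add_lie_lie, ← lie_skew, neg_add_cancel]

/-- With equal forks the sum over one fork already vanishes, so the half is special without dividing
by 2. This is what makes integral statements possible. -/
theorem halfTree₄_mem_special (a b : Fin n) : halfTree₄ R a b ∈ special R n 3 := by
  refine tangentialOf_mem_special (k := 2) (fun m => ?_) ?_
  · exact add_mem (Submodule.smul_mem _ _ (lie_x_lie_mem_freePart b a b))
      (Submodule.smul_mem _ _ (lie_lie_x_mem_freePart a b a))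
  · simp only [add_lie, Finset.sum_add_distrib, sum_kron_lie]
    rw [lie_lie_add_lie_lie, lie_self]

theorem strut_x (i j a : Fin n) : strut R i j (x R a) =
    kron R a i • ⁅x R j, x R i⁆ - kron R a j • ⁅x R j, x R i⁆ := by
  rw [strut, tangentialOf_x, add_lie, smul_lie, smul_lie, kron_comm a i, kron_comm a j, kron,
    kron]
  split_ifs with h h' h' <;> subst_vars <;> simp

/-- The strut sends `x i` to `⁅x j, x i⁆` and `x j` to `⁅x i, x j⁆`, so its bracket with a tree
grafts the corresponding fork at each leaf labelled `i` or `j`. The minus signs come from turning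
the second leaf of a fork into the first. -/
theorem lie_strut_tree₄ (i j a b c d : Fin n) :
    ⁅strut R i j, tree₄ R a b c d⁆ =
      ((kron R a i • tree₅ R j i b c d + kron R a j • tree₅ R i j b c d) -
        (kron R b i • tree₅ R j i a c d + kron R b j • tree₅ R i j a c d)) +
      ((kron R c i • tree₅ R j i d a b + kron R c j • tree₅ R i j d a b) -
        (kron R d i • tree₅ R j i c a b + kron R d j • tree₅ R i j c a b)) := by
  conv_lhs => rw [strut, tree₄, lie_tangentialOf]
  rw [← strut, ← tree₄]
  simp only [tree₅, ← map_smul, ← map_add, ← map_sub]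
  congr 1
  funext m
  simp only [Pi.smul_apply, Pi.add_apply, Pi.sub_apply, map_add, map_smul, LieDerivation.apply_lie_eq_add, strut_x]
  rw [tree₄, tangentialOf_x, tangentialOf_x]
  have hs (u v w : Free R n) (h : ⁅v, u⁆ = w) : ⁅u, v⁆ = -w := by rw [← h, lie_skew]
  have hI (u : Free R n) := hs u (x R i) _ rfl
  have hJ (u : Free R n) := hs u (x R j) _ rfl
  simp only [kron_comm i m, kron_comm j m]
  generalize x R a = A, x R b = B, x R c = C, x R d = D
  generalize x R i = I, x R j = J at *
  have hK (u : Free R n) := hs u ⁅J, I⁆ _ rfl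
  -- Products of Kronecker symbols are brought to a normal form in which `m` is compared only with
  -- `i` or `j`.
  have hk (p q : Fin n) (u : Free R n) :
      kron R p m • kron R m q • u = kron R m q • kron R p q • u := by
    rcases eq_or_ne m q with rfl | h
    · rw [smul_comm]
    · simp [kron_ne h]
  simp only [lie_add, add_lie, lie_sub, sub_lie, lie_smul, smul_lie, smul_add, hk]
  simp only [hs I J _ rfl, hs A ⁅C, D⁆ _ rfl, hs C ⁅A, B⁆ _ rfl, lie_neg, neg_lie, hK,
    hI ⁅B, ⁅C, D⁆⁆, hI ⁅⁅C, D⁆, A⁆, hI ⁅D, ⁅A, B⁆⁆, hI ⁅⁅A, B⁆, C⁆,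
    hJ ⁅B, ⁅C, D⁆⁆, hJ ⁅⁅C, D⁆, A⁆, hJ ⁅D, ⁅A, B⁆⁆, hJ ⁅⁅A, B⁆, C⁆]
  module

end Trees

/-! ### Relations among five-leaf trees. -/

section Relations

variable {R : Type*} [CommRing R] {n : ℕ}

theorem lie_strut_halfTree₄ (i j a b : Fin n) :
    ⁅strut R i j, halfTree₄ R a b⁆ =
      (kron R a i • tree₅ R j i b a b + kron R a j • tree₅ R i j b a b) -
        (kron R b i • tree₅ R j i a a b + kron R b j • tree₅ R i j a a b) := by
  conv_lhs => rw [strut, halfTree₄, lie_tangentialOf]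
  rw [← strut, ← halfTree₄]
  simp only [tree₅, ← map_smul, ← map_add, ← map_sub]
  congr 1
  funext m
  simp only [Pi.smul_apply, Pi.add_apply, Pi.sub_apply, map_add, map_smul,
    LieDerivation.apply_lie_eq_add, strut_x]
  rw [halfTree₄, tangentialOf_x, tangentialOf_x]
  have hs (u v w : Free R n) (h : ⁅v, u⁆ = w) : ⁅u, v⁆ = -w := by rw [← h, lie_skew]
  have hI (u : Free R n) := hs u (x R i) _ rfl
  have hJ (u : Free R n) := hs u (x R j) _ rfl
  simp only [kron_comm i m, kron_comm j m]
  generalize x R a = A, x R b = B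
  generalize x R i = I, x R j = J at *
  have hK (u : Free R n) := hs u ⁅J, I⁆ _ rfl
  have hk (p q : Fin n) (u : Free R n) :
      kron R p m • kron R m q • u = kron R m q • kron R p q • u := by
    rcases eq_or_ne m q with rfl | h
    · rw [smul_comm]
    · simp [kron_ne h]
  simp only [lie_add, add_lie, lie_sub, sub_lie, lie_smul, smul_lie, smul_add, hk]
  simp only [hs I J _ rfl, hs A ⁅A, B⁆ _ rfl, lie_neg, neg_lie, hK,
    hI ⁅B, ⁅A, B⁆⁆, hI ⁅⁅A, B⁆, A⁆, hJ ⁅B, ⁅A, B⁆⁆, hJ ⁅⁅A, B⁆, A⁆]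
  module

theorem tree₅_swap_left (p q r s e : Fin n) : tree₅ R q p r s e = -tree₅ R p q r s e := by
  simp only [tree₅, ← map_neg]
  congr 1
  funext m
  simp only [Pi.neg_apply]
  rw [← lie_skew (x R q) (x R p), ← lie_skew (x R p), ← lie_skew _ (x R q)]
  simp only [lie_neg, neg_lie]
  module

/-- Exchanging the forks keeps the order inside each and reverses the cyclic order at the middle
vertex, whence one sign. -/
theorem tree₅_reverse (p q r s e : Fin n) : tree₅ R s e r p q = -tree₅ R p q r s e := by
  simp only [tree₅, ← map_neg]
  congr 1
  funext m
  simp only [Pi.neg_apply]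
  rw [← lie_skew (x R r) ⁅x R p, x R q⁆, ← lie_skew (x R r) ⁅x R s, x R e⁆,
    ← lie_skew ⁅x R p, x R q⁆ ⁅x R s, x R e⁆]
  simp only [lie_neg, neg_lie]
  module

theorem tree₅_swap_right (p q r s e : Fin n) : tree₅ R p q r e s = -tree₅ R p q r s e := by
  rw [tree₅_reverse, tree₅_swap_left, tree₅_reverse, neg_neg]

theorem tree₅_left_eq (p r s e : Fin n) : tree₅ R p p r s e = 0 := by
  rw [tree₅, ← map_zero (tangentialOf R)]
  congr 1
  funext m
  rw [← lie_skew (x R p) ⁅x R r, ⁅x R s, x R e⁆⁆]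
  simp only [lie_self, zero_lie, lie_zero, Pi.zero_apply]
  module

theorem tree₅_right_eq (p q r s : Fin n) : tree₅ R p q r s s = 0 := by
  rw [tree₅_reverse, tree₅_left_eq, neg_zero]

/-- Reversal gives only that twice the tree is zero; here the terms cancel directly, with no
division by 2. -/
theorem tree₅_forks_eq (a b r : Fin n) : tree₅ R a b r a b = 0 := by
  rw [tree₅, ← map_zero (tangentialOf R)]
  congr 1
  funext m
  rw [← lie_skew (x R r) ⁅x R a, x R b⁆]
  simp only [lie_neg, neg_lie, lie_self, Pi.zero_apply]
  module

/-- The IHX relation at the edge between the fork `p, q` and the middle vertex. -/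
theorem tree₅_jacobi (p q r s e : Fin n) :
    tree₅ R p q r s e = tree₅ R p r q s e - tree₅ R q r p s e := by
  simp only [tree₅, ← map_sub]
  congr 1
  funext m
  simp only [Pi.sub_apply]
  generalize ⁅x R s, x R e⁆ = U
  generalize x R p = P, x R q = Q, x R r = T, x R s = S, x R e = E
  have h1 : ⁅⁅P, Q⁆, T⁆ = ⁅⁅P, T⁆, Q⁆ - ⁅⁅Q, T⁆, P⁆ := by
    rw [lie_lie P, ← lie_skew P ⁅Q, T⁆, ← lie_skew Q ⁅P, T⁆]
    abel
  have h2 : ⁅Q, ⁅T, U⁆⁆ = ⁅T, ⁅Q, U⁆⁆ - ⁅U, ⁅Q, T⁆⁆ := by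
    rw [leibniz_lie Q T U, ← lie_skew ⁅Q, T⁆ U]
    abel
  have h3 : ⁅⁅T, U⁆, P⁆ = ⁅U, ⁅P, T⁆⁆ - ⁅T, ⁅P, U⁆⁆ := by
    rw [lie_lie T U P, ← lie_skew U P, ← lie_skew T P, lie_neg, lie_neg]
    abel
  have h4 : ⁅U, ⁅P, Q⁆⁆ = ⁅⁅Q, U⁆, P⁆ - ⁅⁅P, U⁆, Q⁆ := by
    rw [leibniz_lie U P Q, ← lie_skew U P, ← lie_skew U Q, neg_lie, lie_neg, ← lie_skew P ⁅Q, U⁆]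
    abel
  simp only [h1, h2, h3, h4, lie_sub, sub_lie]
  module

/-! ### Five-leaf trees as brackets of degrees three and one. -/

variable (R n) in
/-- The span of the brackets of special derivations of degrees three and one. -/
abbrev brackets₃₁ : Submodule R (LieDerivation R (Free R n) (Free R n)) :=
  bracketSpan (special R n 3) (special R n 1)

theorem lie_strut_mem_brackets₃₁ {D : LieDerivation R (Free R n) (Free R n)}
    (hD : D ∈ special R n 3) (i j : Fin n) : ⁅strut R i j, D⁆ ∈ brackets₃₁ R n := by
  rw [← lie_skew]
  exact neg_mem (Submodule.subset_span ⟨D, hD, _, strut_mem_special i j, rfl⟩)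

/-- Since `i` labels only one leaf of the four-leaf tree and `j` labels none, the strut grafts
exactly one fork. -/
theorem tree₅_mem_of_fork {i j b c d : Fin n} (hij : i ≠ j) (hb : b ≠ i) (hc : c ≠ i)
    (hd : d ≠ i) (hb' : b ≠ j) (hc' : c ≠ j) (hd' : d ≠ j) :
    tree₅ R j i b c d ∈ brackets₃₁ R n := by
  have h := lie_strut_mem_brackets₃₁ (tree₄_mem_special (R := R) i b c d) i j
  rw [lie_strut_tree₄] at h
  simpa [kron_ne, *] using h

theorem tree₅_mem_of_two_two {a b c : Fin n} (hab : a ≠ b) (hac : a ≠ c) (hbc : b ≠ c) :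
    tree₅ R a b b a c ∈ brackets₃₁ R n := by
  have h := lie_strut_mem_brackets₃₁ (halfTree₄_mem_special (R := R) a b) a c
  rw [lie_strut_halfTree₄] at h
  simpa [kron_ne, hab, hac, hbc, hab.symm, tree₅_swap_right a b b a c, tree₅_reverse a b b c a]
    using h

/-- The strut `a, b` meets three leaves of the tree `a b a c`. One graft has equal forks and
vanishes, one is the tree of `tree₅_mem_of_two_two`, and the third is the wanted one. -/
theorem tree₅_mem_of_three {a b c : Fin n} (hab : a ≠ b) (hac : a ≠ c) (hbc : b ≠ c) :
    tree₅ R a b a a c ∈ brackets₃₁ R n := by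
  have h := lie_strut_mem_brackets₃₁ (tree₄_mem_special (R := R) a b a c) a b
  rw [lie_strut_tree₄] at h
  simp only [kron_self, kron_ne hab, kron_ne hab.symm, kron_ne hac.symm, kron_ne hbc.symm,
    one_smul, zero_smul, add_zero, zero_add, sub_zero, tree₅_swap_left a b, tree₅_forks_eq,
    neg_zero] at h
  have h' := add_mem h (tree₅_mem_of_two_two (R := R) hab hac hbc)
  rw [← neg_mem_iff]
  convert h' using 1
  abel

/-- Write T(b,c,d) for the tree. Modulo brackets it is antisymmetric in c, d (graft at both leaves
`a`) and symmetric in b, c (Jacobi, the third tree having an isolated fork). Then it is symmetric in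
b, d, while reversal makes it antisymmetric there; hence 2T vanishes. -/
theorem tree₅_two_nsmul_mem {a b c d : Fin n} (hab : a ≠ b) (hac : a ≠ c) (had : a ≠ d)
    (hbc : b ≠ c) (hbd : b ≠ d) (hcd : c ≠ d) :
    2 • tree₅ R a b c a d ∈ brackets₃₁ R n := by
  have h23 {b c d : Fin n} (hab : a ≠ b) (hac : a ≠ c) (had : a ≠ d)
      (hbc : b ≠ c) (hbd : b ≠ d) : tree₅ R a b c a d + tree₅ R a b d a c ∈ brackets₃₁ R n := by
    have h := lie_strut_mem_brackets₃₁ (tree₄_mem_special (R := R) a c a d) a b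
    rw [lie_strut_tree₄] at h
    simp only [kron_self, kron_ne hab, kron_ne hac.symm, kron_ne had.symm, kron_ne hbc.symm,
      kron_ne hbd.symm,
      one_smul, zero_smul, add_zero, sub_zero, tree₅_swap_left a b] at h
    rw [← neg_mem_iff]
    convert h using 1
    abel
  have h12 : tree₅ R b c a a d ∈ brackets₃₁ R n :=
    tree₅_mem_of_fork hbc.symm hac hac hcd.symm hab hab hbd.symm
  have h := neg_mem (add_mem h12 (h23 had hab hac hbd.symm hcd.symm))
  convert h using 1
  rw [two_nsmul]
  nth_rewrite 1 [tree₅_jacobi]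
  rw [tree₅_reverse a d b a c, tree₅_reverse a d c a b]
  abel

/-- The scalar `t` lets one case analysis serve both the integral claim (`t = 1`) and the rational
one (`t = 2`). -/
theorem smul_tree₅_mem {t : R} (ht : ∀ a b c d : Fin n, a ≠ b → a ≠ c → a ≠ d → b ≠ c → b ≠ d →
      c ≠ d → t • tree₅ R a b c a d ∈ brackets₃₁ R n) (p q r s e : Fin n) :
    t • tree₅ R p q r s e ∈ brackets₃₁ R n := by
  have shared {a b c : Fin n} (r : Fin n) (hab : a ≠ b) (hac : a ≠ c) :
      t • tree₅ R a b r a c ∈ brackets₃₁ R n := by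
    rcases eq_or_ne b c with rfl | hbc
    · simp [tree₅_forks_eq]
    rcases eq_or_ne r a with rfl | hra
    · exact Submodule.smul_mem _ _ (tree₅_mem_of_three hab hac hbc)
    rcases eq_or_ne r b with rfl | hrb
    · exact Submodule.smul_mem _ _ (tree₅_mem_of_two_two hab hac hbc)
    rcases eq_or_ne r c with rfl | hrc
    · rw [tree₅_reverse]
      exact Submodule.smul_mem _ _ (neg_mem (tree₅_mem_of_two_two hac hab hbc.symm))
    · exact ht a b r c hab hra.symm hac hrb.symm hbc hrc
  rcases eq_or_ne p q with rfl | hpq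
  · simp [tree₅_left_eq]
  rcases eq_or_ne s e with rfl | hse
  · simp [tree₅_right_eq]
  rcases eq_or_ne p s with rfl | hps
  · exact shared r hpq hse
  rcases eq_or_ne p e with rfl | hpe
  · rw [tree₅_swap_right, smul_neg, neg_mem_iff]
    exact shared r hpq hse.symm
  rcases eq_or_ne q s with rfl | hqs
  · rw [tree₅_swap_left, smul_neg, neg_mem_iff]
    exact shared r hpq.symm hse
  rcases eq_or_ne q e with rfl | hqe
  · rw [tree₅_swap_left, tree₅_swap_right, neg_neg]
    exact shared r hpq.symm hse.symm
  refine Submodule.smul_mem _ _ ?_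
  -- The forks are now disjoint, so `r` meets at most one of them; the other is isolated, and
  -- reversal puts it on the left if needed.
  by_cases h : r = p ∨ r = q
  · rw [tree₅_reverse]
    refine neg_mem (tree₅_mem_of_fork ?_ ?_ ?_ ?_ ?_ ?_ ?_) <;> grind
  · refine tree₅_mem_of_fork ?_ ?_ ?_ ?_ ?_ ?_ ?_ <;> grind

end Relations

/-! ### Extracting trees from associative words. -/

section Spanning

variable (R : Type*) [CommRing R] {n : ℕ}

attribute [local instance] LieRing.ofAssociativeRing LieAlgebra.ofAssociativeAlgebra

/-- The map from the free Lie algebra to the monoid algebra of the free monoid. -/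
def toAssoc : Free R n →ₗ⁅R⁆ MonoidAlgebra R (FreeMonoid (Fin n)) :=
  FreeLieAlgebra.lift R fun i => MonoidAlgebra.single (FreeMonoid.of i) 1

variable {R}

theorem toAssoc_x (i : Fin n) :
    toAssoc R (x R i) = MonoidAlgebra.single (FreeMonoid.of i) 1 := by
  simp [toAssoc]

variable (R)

/-- The linear map that is `f` on words. -/
def wordLift {M : Type*} [AddCommGroup M] [Module R M] (f : FreeMonoid (Fin n) → M) :
    MonoidAlgebra R (FreeMonoid (Fin n)) →ₗ[R] M :=
  Finsupp.linearCombination R f ∘ₗ (MonoidAlgebra.coeffLinearEquiv R).toLinearMap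

variable {R}

theorem wordLift_single {M : Type*} [AddCommGroup M] [Module R M] (f : FreeMonoid (Fin n) → M)
    (w : FreeMonoid (Fin n)) : wordLift R f (MonoidAlgebra.single w 1) = f w := by
  simp [wordLift]

/-- On words of length five with first letter `m` and last letter `b`, the right-normed commutator
of the last four letters, with a weight `χ` that depends on the multidegree only; zero on all other
words. -/
def rootMap (χ : Multiset (Fin n) → R) (b m : Fin n) (w : FreeMonoid (Fin n)) : Free R n :=
  match w.toList with
  | [j, p, q, r, s] => (χ ({j} + ({p} + ({q} + ({r} + {s})))) * kron R j m * kron R s b) •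
      ⁅x R p, ⁅x R q, ⁅x R r, x R s⁆⁆⁆
  | _ => 0

/-- Words ending in `i` come from `w * i`, with `w` in the expansion of the inner commutator; sorted
by first letter they give the values of the tree at its other four leaves. Words beginning with `i`
come from `-i * w`; for each choice of final position the right-normed commutators add up to the
inner commutator itself, a refinement of the Dynkin–Specht–Wever identity. -/
theorem wordLift_rootMap (χ : Multiset (Fin n) → R) (b m p q r s i : Fin n) :
    wordLift R (rootMap χ b m) (toAssoc R ⁅⁅⁅⁅x R p, x R q⁆, x R r⁆, x R s⁆, x R i⁆) =
      χ ({i} + ({p} + ({q} + ({r} + {s})))) •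
        (kron R i b • (kron R p m • ⁅x R q, ⁅x R r, ⁅x R s, x R i⁆⁆⁆ +
          kron R q m • ⁅⁅x R r, ⁅x R s, x R i⁆⁆, x R p⁆ +
          kron R r m • ⁅⁅x R s, x R i⁆, ⁅x R p, x R q⁆⁆ +
          kron R s m • ⁅x R i, ⁅⁅x R p, x R q⁆, x R r⁆⁆) -
        (kron R i m * (kron R p b + kron R q b + kron R r b + kron R s b)) •
          ⁅⁅⁅x R p, x R q⁆, x R r⁆, x R s⁆) := by
  have word (j p q r s : Fin n) : rootMap χ b m (FreeMonoid.of j * FreeMonoid.of p *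
      FreeMonoid.of q * FreeMonoid.of r * FreeMonoid.of s) =
        (χ ({j} + ({p} + ({q} + ({r} + {s})))) * kron R j m * kron R s b) •
          ⁅x R p, ⁅x R q, ⁅x R r, x R s⁆⁆⁆ := rfl
  simp only [LieHom.map_lie, toAssoc_x, Ring.lie_def, mul_sub, sub_mul,
    MonoidAlgebra.single_mul_single, mul_one, map_sub, wordLift_single, ← mul_assoc, word]
  -- All the words rearrange the same five letters, so every argument of `χ` becomes the same
  -- multiset.
  simp only [add_comm, add_left_comm, add_assoc]
  generalize χ _ = t
  generalize x R p = P, x R q = Q, x R r = T, x R s = S, x R i = I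
  have hs : ⁅P, ⁅Q, ⁅T, S⁆⁆⁆ = ⁅⁅⁅P, Q⁆, T⁆, S⁆ + ⁅Q, ⁅P, ⁅T, S⁆⁆⁆ + ⁅T, ⁅P, ⁅Q, S⁆⁆⁆
      - ⁅T, ⁅Q, ⁅P, S⁆⁆⁆ := by
    rw [lie_lie ⁅P, Q⁆ T S, lie_lie P Q, lie_lie P Q, lie_sub]
    abel
  have hr : ⁅S, ⁅P, ⁅Q, T⁆⁆⁆ = ⁅S, ⁅Q, ⁅P, T⁆⁆⁆ - ⁅⁅⁅P, Q⁆, T⁆, S⁆ := by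
    rw [← lie_skew _ S, lie_lie P Q T, lie_sub]
    abel
  have hq : ⁅S, ⁅T, ⁅P, Q⁆⁆⁆ = ⁅⁅⁅P, Q⁆, T⁆, S⁆ := by
    rw [← lie_skew _ S, ← lie_skew _ T, lie_neg, neg_neg]
  have hp : ⁅S, ⁅T, ⁅Q, P⁆⁆⁆ = -⁅⁅⁅P, Q⁆, T⁆, S⁆ := by
    rw [← hq, ← lie_skew P Q, lie_neg, lie_neg, neg_neg]
  have h1 : ⁅⁅T, ⁅S, I⁆⁆, P⁆ = -⁅P, ⁅T, ⁅S, I⁆⁆⁆ := (lie_skew _ _).symm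
  have h2 : ⁅⁅S, I⁆, ⁅P, Q⁆⁆ = ⁅Q, ⁅P, ⁅S, I⁆⁆⁆ - ⁅P, ⁅Q, ⁅S, I⁆⁆⁆ := by
    rw [← lie_skew, lie_lie P Q, neg_sub]
  have h3 : ⁅I, ⁅⁅P, Q⁆, T⁆⁆ = ⁅Q, ⁅P, ⁅T, I⁆⁆⁆ - ⁅P, ⁅Q, ⁅T, I⁆⁆⁆ + ⁅T, ⁅P, ⁅Q, I⁆⁆⁆
      - ⁅T, ⁅Q, ⁅P, I⁆⁆⁆ := by
    rw [← lie_skew, lie_lie ⁅P, Q⁆ T I, lie_lie P Q, lie_lie P Q, lie_sub]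
    abel
  rw [hs, hr, hq, hp, h1, h2, h3]
  module

end Spanning

/-! ### Multidegree components and the spanning theorem. -/

section Spanning

variable {R : Type*} [CommRing R] {n : ℕ}

/-- The multidegree of a word of length four. -/
def wordDegree (w : Fin n × Fin n × Fin n × Fin n) : Multiset (Fin n) :=
  {w.1} + ({w.2.1} + ({w.2.2.1} + {w.2.2.2}))

variable (R) in
/-- The left-normed commutator of a word of length four. -/
def wordLie (w : Fin n × Fin n × Fin n × Fin n) : Free R n :=
  ⁅⁅⁅x R w.1, x R w.2.1⁆, x R w.2.2.1⁆, x R w.2.2.2⁆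

theorem freePart_four_le : freePart R n 4 ≤ Submodule.span R (Set.range (wordLie R)) := by
  refine Submodule.span_mono ?_
  rintro _ ⟨w, hw, rfl⟩
  match w, hw with
  | [p, q, r, s], _ => exact ⟨(p, q, r, s), rfl⟩

theorem natCast_count_wordDegree (w : Fin n × Fin n × Fin n × Fin n) (b : Fin n) :
    ((wordDegree w).count b : R) =
      kron R w.1 b + kron R w.2.1 b + kron R w.2.2.1 b + kron R w.2.2.2 b := by
  simp only [wordDegree, Multiset.count_add, Multiset.count_singleton, kron, Nat.cast_add,
    Nat.cast_ite, Nat.cast_one, Nat.cast_zero, eq_comm (a := b)]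
  ring

/-- The component of multidegree `α` of the tangential derivation with coefficients `a`. -/
def component (a : Fin n → Fin n × Fin n × Fin n × Fin n → R) (α : Multiset (Fin n)) :
    LieDerivation R (Free R n) (Free R n) :=
  tangentialOf R fun m =>
    ∑ w, if {m} + wordDegree w = α then a m w • wordLie R w else 0

/-- The components depend on the chosen coefficients `a`, as the `wordLie w` need not be
independent; only their sum matters. -/
theorem tangentialOf_eq_sum_component (a : Fin n → Fin n × Fin n × Fin n × Fin n → R) :
    tangentialOf R (fun m => ∑ w, a m w • wordLie R w) =
      ∑ α ∈ Finset.univ.image (fun z : Fin n × Fin n × Fin n × Fin n × Fin n =>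
        {z.1} + wordDegree z.2), component a α := by
  simp only [component, ← map_sum]
  congr 1
  funext m
  rw [Finset.sum_apply, Finset.sum_comm]
  refine Finset.sum_congr rfl fun w _ => ?_
  rw [Finset.sum_ite_eq, if_pos]
  exact Finset.mem_image.mpr ⟨(m, w), Finset.mem_univ _, rfl⟩

theorem component_replicate (a : Fin n → Fin n × Fin n × Fin n × Fin n → R) (k : ℕ) (b : Fin n) :
    component a (Multiset.replicate k b) = 0 := by
  rw [component, ← map_zero (tangentialOf R)]
  congr 1
  funext m
  refine Finset.sum_eq_zero fun w _ => ?_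
  split_ifs with h
  · have h1 : w.1 = b := Multiset.eq_of_mem_replicate (n := k) (h ▸ by simp [wordDegree])
    have h2 : w.2.1 = b := Multiset.eq_of_mem_replicate (n := k) (h ▸ by simp [wordDegree])
    simp [wordLie, h1, h2]
  · rfl

theorem count_smul_component {a : Fin n → Fin n × Fin n × Fin n × Fin n → R}
    (ha : ∑ i, ∑ w, a i w • ⁅wordLie R w, x R i⁆ = 0) (α : Multiset (Fin n)) (b : Fin n) :
    (α.count b) • component a α =
      ∑ w, if {b} + wordDegree w = α then
        a b w • tree₅ R w.1 w.2.1 w.2.2.1 w.2.2.2 b else 0 := by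
  have tree (w : Fin n × Fin n × Fin n × Fin n) :
      (if {b} + wordDegree w = α then
        a b w • tree₅ R w.1 w.2.1 w.2.2.1 w.2.2.2 b else 0) =
      tangentialOf R fun m => if {b} + wordDegree w = α then a b w •
        (kron R w.1 m • ⁅x R w.2.1, ⁅x R w.2.2.1, ⁅x R w.2.2.2, x R b⁆⁆⁆ +
          kron R w.2.1 m • ⁅⁅x R w.2.2.1, ⁅x R w.2.2.2, x R b⁆⁆, x R w.1⁆ +
          kron R w.2.2.1 m • ⁅⁅x R w.2.2.2, x R b⁆, ⁅x R w.1, x R w.2.1⁆⁆ +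
          kron R w.2.2.2 m • ⁅x R b, ⁅⁅x R w.1, x R w.2.1⁆, x R w.2.2.1⁆⁆ +
          kron R b m • wordLie R w) else 0 := by
    split_ifs
    · rw [tree₅, ← map_smul]; rfl
    · exact (map_zero _).symm
  simp only [tree, component, ← map_sum, ← map_nsmul]
  congr 1
  funext m
  have h := congrArg
    (fun u => wordLift R (rootMap (fun β => if β = α then (1 : R) else 0) b m) (toAssoc R u)) ha
  simp only [map_sum, map_smul, wordLie, wordLift_rootMap, map_zero, smul_sub,
    Finset.sum_sub_distrib, sub_eq_zero] at h
  -- The words ending in `i` survive only for `i = b`, those beginning with `i` only for `i = m`.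
  rw [Finset.sum_eq_single b, Finset.sum_eq_single m] at h
  · simp only [kron_self, one_smul, one_mul, ← natCast_count_wordDegree] at h
    rw [Finset.sum_apply, Pi.smul_apply, Finset.smul_sum]
    have split (w : Fin n × Fin n × Fin n × Fin n) (u v : Free R n) :
        (if {b} + wordDegree w = α then a b w • (u + v) else 0) =
          a b w • (if {b} + wordDegree w = α then (1 : R) else 0) • u +
            a b w • (if {b} + wordDegree w = α then (1 : R) else 0) • v := by
      split_ifs <;> simp
    simp only [split]
    rw [Finset.sum_add_distrib]
    refine Eq.trans ?_ (congrArg (· + _) h.symm)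
    rw [← Finset.sum_add_distrib]
    refine Finset.sum_congr rfl fun w _ => ?_
    change _ = a m w • (if {m} + wordDegree w = α then (1 : R) else 0) •
      ((wordDegree w).count b : R) • wordLie R w + _
    rw [← Nat.cast_smul_eq_nsmul R]
    -- For `m = b` the multiplicity in `α` exceeds that in `w` by one; the root leaf `b` of the tree
    -- supplies this extra term.
    rcases eq_or_ne b m with rfl | hbm
    · split_ifs with hw
      · rw [← hw, Multiset.count_add, Multiset.count_singleton_self, kron_self]
        push_cast
        module
      · simp
    · rw [kron_ne hbm, zero_smul, smul_zero, smul_zero, add_zero]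
      split_ifs with hw
      · rw [← hw, Multiset.count_add, Multiset.count_singleton, if_neg hbm]
        push_cast
        module
      · simp
  · intro i _ hi
    simp [kron_ne hi]
  · simp
  · intro i _ hi
    simp [kron_ne hi]
  · simp

theorem component_mem {a : Fin n → Fin n × Fin n × Fin n × Fin n → R}
    (ha : ∑ i, ∑ w, a i w • ⁅wordLie R w, x R i⁆ = 0) {α : Multiset (Fin n)} (hα : α.card = 5)
    {N : Submodule R (LieDerivation R (Free R n) (Free R n))}
    (hN : ∀ p q r s e, tree₅ R p q r s e ∈ N) : component a α ∈ N := by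
  have hb (b : Fin n) : (α.count b) • component a α ∈ N := by
    rw [count_smul_component ha]
    refine sum_mem fun w _ => ?_
    split_ifs
    · exact Submodule.smul_mem _ _ (hN _ _ _ _ _)
    · exact zero_mem _
  have h5 : 5 • component a α ∈ N := by
    rw [← hα, ← Multiset.toFinset_sum_count_eq, Finset.sum_smul]
    exact sum_mem fun b _ => hb b
  obtain ⟨b, hbα⟩ : ∃ b, b ∈ α := Multiset.card_pos_iff_exists_mem.mp (by omega)
  have hpos := Multiset.count_pos.mpr hbα
  have hle := Multiset.count_le_card b α
  rcases eq_or_ne (α.count b) 5 with h | h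
  · have : α = Multiset.replicate 5 b := by
      rw [Multiset.eq_replicate]
      refine ⟨hα, fun c hc => ?_⟩
      exact (Multiset.count_eq_card.mp (h.trans hα.symm) c hc).symm
    rw [this, component_replicate]
    exact zero_mem _
  · have hcop : Nat.Coprime (α.count b) 5 := by
      rw [Nat.coprime_comm, Nat.Prime.coprime_iff_not_dvd Nat.prime_five]
      omega
    obtain ⟨u, v, huv⟩ := Nat.isCoprime_iff_coprime.mpr hcop
    have : component a α = u • ((α.count b) • component a α) + v • (5 • component a α) := by
      rw [← natCast_zsmul, ← natCast_zsmul, smul_smul, smul_smul, ← add_smul, huv, one_smul]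
    rw [this]
    exact add_mem (zsmul_mem (hb b) u) (zsmul_mem h5 v)

theorem special_four_le {N : Submodule R (LieDerivation R (Free R n) (Free R n))}
    (hN : ∀ p q r s e, tree₅ R p q r s e ∈ N) : special R n 4 ≤ N := by
  rintro D ⟨hD, hD'⟩
  choose c hc hDc using (mem_tangential_iff (k := 3) R).mp hD
  choose a ha using fun m => (Submodule.mem_span_range_iff_exists_fun R).mp (freePart_four_le (hc m))
  have hDa : D = tangentialOf R fun m => ∑ w, a m w • wordLie R w := by
    refine derivation_ext R fun m => ?_
    rw [hDc, tangentialOf_x, ha]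
  have h0 : ∑ i, ∑ w, a i w • ⁅wordLie R w, x R i⁆ = 0 := by
    rw [← hD']
    refine Finset.sum_congr rfl fun i _ => ?_
    rw [hDc, ← ha, sum_lie]
    simp only [smul_lie]
  rw [hDa, tangentialOf_eq_sum_component]
  refine sum_mem fun α hα => component_mem h0 ?_ hN
  obtain ⟨z, _, rfl⟩ := Finset.mem_image.mp hα
  simp [wordDegree]

end Spanning

/-! ### Passage to the graded Lie algebra, base change and homology. -/

section Homology

variable {R : Type*} [CommRing R] {n : ℕ}

theorem smul_mem_brackets₃₁ {t : R} (ht : ∀ a b c d : Fin n, a ≠ b → a ≠ c → a ≠ d → b ≠ c →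
      b ≠ d → c ≠ d → t • tree₅ R a b c a d ∈ brackets₃₁ R n)
    {D : LieDerivation R (Free R n) (Free R n)} (hD : D ∈ special R n 4) :
    t • D ∈ brackets₃₁ R n :=
  special_four_le (N := (brackets₃₁ R n).comap (LinearMap.lsmul R _ t))
    (smul_tree₅_mem ht) hD

theorem special_le_specialLie (k : ℕ) :
    special R n (k + 1) ≤ (specialLie R n).toSubmodule :=
  le_iSup (fun k => special R n (k + 1)) k

theorem mem_bracketSpan_part {D : specialLie R n}
    (hD : (D : LieDerivation R (Free R n) (Free R n)) ∈ brackets₃₁ R n) :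
    D ∈ bracketSpan (part R n 3) (part R n 1) := by
  suffices h : brackets₃₁ R n ≤
      (bracketSpan (part R n 3) (part R n 1)).map (specialLie R n).toSubmodule.subtype by
    obtain ⟨E, hE, hED⟩ := h hD
    rwa [← Subtype.ext hED]
  refine Submodule.span_le.mpr ?_
  rintro _ ⟨u, hu, v, hv, rfl⟩
  exact ⟨⁅(⟨u, special_le_specialLie 2 hu⟩ : specialLie R n),
    (⟨v, special_le_specialLie 0 hv⟩ : specialLie R n)⁆,
    Submodule.subset_span ⟨_, hu, _, hv, rfl⟩, rfl⟩

theorem lie_mem_part_four {u v : specialLie R n} (hu : u ∈ part R n 3) (hv : v ∈ part R n 1) :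
    ⁅u, v⁆ ∈ part R n 4 :=
  lie_mem_special R (k := 2) (l := 0) hu hv

theorem part_four_eq (ht : ∀ a b c d : Fin n, a ≠ b → a ≠ c → a ≠ d → b ≠ c → b ≠ d → c ≠ d →
      tree₅ R a b c a d ∈ brackets₃₁ R n) :
    part R n 4 = bracketSpan (part R n 3) (part R n 1) := by
  refine le_antisymm (fun D hD => mem_bracketSpan_part ?_) (Submodule.span_le.mpr ?_)
  · rw [← one_smul R (D : LieDerivation R (Free R n) (Free R n))]
    exact smul_mem_brackets₃₁ (by simpa only [one_smul] using ht) hD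
  · rintro _ ⟨u, hu, v, hv, rfl⟩
    exact lie_mem_part_four hu hv

/-- Before base change `2 • D` is in the bracket span for each `D` of degree 4; a left inverse of 2
in `A` removes the factor. The other inclusion is additivity of degrees. -/
theorem partExt_four_eq (A : Type*) [CommRing A] [Algebra R A] (h2 : IsUnit (2 : A)) :
    partExt R n A 4 = bracketSpan (partExt R n A 3) (partExt R n A 1) := by
  apply le_antisymm
  · rw [partExt, Submodule.baseChange_eq_span, Submodule.span_le]
    rintro _ ⟨D, hD, rfl⟩
    obtain ⟨t, ht⟩ := h2.exists_left_inv
    have h : (2 : R) • D ∈ bracketSpan (part R n 3) (part R n 1) := by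
      refine mem_bracketSpan_part (smul_mem_brackets₃₁ (t := 2) ?_ hD)
      intro a b c d hab hac had hbc hbd hcd
      rw [ofNat_smul_eq_nsmul]
      exact tree₅_two_nsmul_mem hab hac had hbc hbd hcd
    have key : bracketSpan (part R n 3) (part R n 1) ≤
        ((bracketSpan (partExt R n A 3) (partExt R n A 1)).restrictScalars R).comap
          (TensorProduct.mk R A (specialLie R n) 1) := by
      refine Submodule.span_le.mpr ?_
      rintro _ ⟨u, hu, v, hv, rfl⟩
      refine Submodule.subset_span ⟨1 ⊗ₜ u, Submodule.tmul_mem_baseChange_of_mem _ hu, 1 ⊗ₜ v,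
        Submodule.tmul_mem_baseChange_of_mem _ hv, ?_⟩
      rw [LieAlgebra.ExtendScalars.bracket_tmul, one_mul]
      rfl
    have h' : (1 : A) ⊗ₜ[R] ((2 : R) • D) ∈
        bracketSpan (partExt R n A 3) (partExt R n A 1) := key h
    have e : (1 : A) ⊗ₜ[R] D = t • (2 : A) • (1 : A) ⊗ₜ[R] D := by
      rw [smul_smul, ht, one_smul]
    rw [SetLike.mem_coe, TensorProduct.mk_apply, e]
    refine Submodule.smul_mem _ t ?_
    rwa [ofNat_smul_eq_nsmul, TensorProduct.tmul_smul, ← ofNat_smul_eq_nsmul A] at h'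
  · refine Submodule.span_le.mpr ?_
    rintro _ ⟨u, hu, v, hv, rfl⟩
    rw [partExt, Submodule.baseChange_eq_span] at hu hv
    rw [SetLike.mem_coe]
    induction hu, hv using Submodule.span_induction₂ with
    | mem_mem u v hu hv =>
      obtain ⟨u, hu, rfl⟩ := hu
      obtain ⟨v, hv, rfl⟩ := hv
      rw [TensorProduct.mk_apply, TensorProduct.mk_apply,
        LieAlgebra.ExtendScalars.bracket_tmul, one_mul]
      exact Submodule.tmul_mem_baseChange_of_mem _ (lie_mem_part_four hu hv)
    | zero_left v hv => rw [zero_lie]; exact zero_mem _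
    | zero_right u hu => rw [lie_zero]; exact zero_mem _
    | add_left u u' v _ _ _ h h' => rw [add_lie]; exact add_mem h h'
    | add_right u v v' _ _ _ h h' => rw [lie_add]; exact add_mem h h'
    | smul_left t u v _ _ h => rw [smul_lie]; exact Submodule.smul_mem _ t h
    | smul_right t u v _ _ h => rw [lie_smul]; exact Submodule.smul_mem _ t h

theorem H1Part_eq_bot {𝔤 : Type*} [LieRing 𝔤] [LieAlgebra R 𝔤] {U V W : Submodule R 𝔤}
    (h : U = bracketSpan V W) : H1Part U = ⊥ := by
  rw [H1Part, h, bracketSpan, Submodule.map_span, Submodule.span_eq_bot]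
  rintro _ ⟨_, ⟨u, _, v, _, rfl⟩, rfl⟩
  exact (LieSubmodule.Quotient.mk_eq_zero' ).mpr
    (LieSubmodule.lie_mem_lie (LieSubmodule.mem_top u) (LieSubmodule.mem_top v))

end Homology

end SpecialDer

end

theorem mainTheorem6 :
    (∀ n : ℕ, 4 ≤ n →
      SpecialDer.partExt ℤ n ℚ 4 =
          SpecialDer.bracketSpan (SpecialDer.partExt ℤ n ℚ 3) (SpecialDer.partExt ℤ n ℚ 1) ∧
        SpecialDer.H1Part (SpecialDer.partExt ℤ n ℚ 4) = ⊥) ∧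
    (SpecialDer.part ℤ 3 4 =
        SpecialDer.bracketSpan (SpecialDer.part ℤ 3 3) (SpecialDer.part ℤ 3 1) ∧
      SpecialDer.H1Part (SpecialDer.part ℤ 3 4) = ⊥) := by
  refine ⟨fun n _ => ?_, ?_⟩
  · have h := SpecialDer.partExt_four_eq (R := ℤ) (n := n) ℚ (IsUnit.mk0 2 two_ne_zero)
    exact ⟨h, SpecialDer.H1Part_eq_bot h⟩
  -- `Fin 3` has no four distinct elements, so the exceptional case is vacuous.
  · have h := SpecialDer.part_four_eq (R := ℤ) (n := 3) (by omega)
    exact ⟨h, SpecialDer.H1Part_eq_bot h⟩
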